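/- Let $N\ge 1$ be an integer, $\ell_1,\dots,\ell_N>0$ and $\alpha>N/2$. Let $\mathbb H^1_e(\mathcal T)$ be the real Hilbert space of all $\underline u=(u_1,\dots,u_N)\in\bigoplus_{j=1}^N H^1(0,\ell_j)$ with $u_j(\ell_j)=0$ and $u_j(0)=u_k(0)$ for all $j,k$, with inner product $$\langle \underline u,\underline v\rangle_{\mathbb H^1_e(\mathcal T)}=\sum_{j=1}^N\int_0^{\ell_j}\big(u_jv_j+\partial_xu_j\,\partial_xv_j\big)\,dx .$$ Consider the Benjamin–Bona–Mahony system on the star-shaped network $\mathcal T$ with edges $(0,\ell_j)$ joined at $x=0$: $$(BBM)\quad\begin{cases}\partial_tu_j-\partial_x^2\partial_tu_j+\partial_xu_j+u_j\,\partial_xu_j=0, & x\in(0,\ell_j),\ t>0,\ 1\le j\le N,\\ u_j(t,0)=u_k(t,0), & 1\le j,k\le N,\\ \sum_{j=1}^N\partial_x\partial_tu_j(t,0)=\alpha\,u_1(t,0)+\frac N3\,u_1(t,0)^2, & t>0,\\ u_j(t,\ell_j)=0, & t>0,\ 1\le j\le N,\\ u_j(0,x)=u_j^0(x), & x\in(0,\ell_j),\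 1\le j\le N.\end{cases}$$ A function $\underline u\in C([0,\infty),\mathbb H^1_e(\mathcal T))$ is a *strong solution* if $\underline u(0)=\underline u^0$ and, at every $t>0$, $\underline u$ has a derivative $\partial_t\underline u(t)\in\mathbb H^1_e(\mathcal T)$ (limit in $\mathbb H^1_e(\mathcal T)$) with $\partial_tu_j(t)\in H^2(0,\ell_j)$ for all $j$, the equation holds for almost every $x\in(0,\ell_j)$ for all $j$, and the flux condition at $x=0$ holds. It is a *weak solution* if for every $\underline\varphi\in\mathbb H^1_e(\mathcal T)$ and every $t\ge 0$ $$\langle\underline u(t),\underline\varphi\rangle_{\mathbb H^1_e(\mathcal T)}=\langle\underline u^0,\underline\varphi\rangle_{\mathbb H^1_e(\mathcal T)}-\int_0^t\Big[\sum_{j=1}^N\int_0^{\ell_j}(\partial_xu_j+u_j\partial_xu_j)\varphi_j\,dx+\big(\alpha u_1(s,0)+\tfrac N3u_1(s,0)^2\big)\varphi_1(0)\Big]ds .$$ Then for every $\underline u^0\in\mathbb H^1_e(\mathcal T)$ the system $(BBM)$ has a unique solution $\underline u\in C([0,\infty),\mathbb H^1_e(\mathcal T))$. Here "solution" may be read as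 strong solution or as weak solution: there is exactly one of each kind, and the two coincide. -/

import Mathlib

open MeasureTheory Set
open scoped ContDiff NNReal

namespace StarBBM

noncomputable section

/-- Lebesgue measure on the open interval `(0, L)`. -/
abbrev edgeMeasure (L : ℝ) : Measure ℝ := volume.restrict (Ioo 0 L)

/-- The real Hilbert space `L²(0, L)`. -/
abbrev EdgeL2 (L : ℝ) : Type := Lp ℝ 2 (edgeMeasure L)

/-- `g` is the weak (distributional) derivative of `f` on `(0, L)`. -/
def HasWeakDeriv {L : ℝ} (f g : EdgeL2 L) : Prop :=
  ∀ φ : ℝ → ℝ, ContDiff ℝ ∞ φ → HasCompactSupport φ → tsupport φ ⊆ Ioo 0 L →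
    ∫ x, f x * deriv φ x ∂(edgeMeasure L) = -∫ x, g x * φ x ∂(edgeMeasure L)

/-- The class `f` has a representative that is continuous on `[0, L]` and takes the value `c` at
the point `p` of `[0, L]`. -/
def HasTrace {L : ℝ} (f : EdgeL2 L) (p c : ℝ) : Prop :=
  ∃ g : ℝ → ℝ, ContinuousOn g (Icc 0 L) ∧ f =ᵐ[edgeMeasure L] g ∧ g p = c

lemma integrable_mul_test {L : ℝ} (f : EdgeL2 L) {ψ : ℝ → ℝ} (hψ : Continuous ψ)
    (hc : HasCompactSupport ψ) : Integrable (fun x => f x * ψ x) (edgeMeasure L) := by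
  have h : MemLp ψ 2 (edgeMeasure L) := (hψ.memLp_of_hasCompactSupport hc).restrict _
  exact (Lp.memLp f).integrable_mul h

lemma HasWeakDeriv.zero {L : ℝ} : HasWeakDeriv (0 : EdgeL2 L) 0 := by
  intro φ _ _ _
  have h := Lp.coeFn_zero ℝ 2 (edgeMeasure L)
  have e : ∀ ψ : ℝ → ℝ, ∫ x, (0 : EdgeL2 L) x * ψ x ∂(edgeMeasure L) = 0 := fun ψ =>
    integral_eq_zero_of_ae (by
      filter_upwards [h] with x hx
      rw [hx]; simp)
  rw [e, e, neg_zero]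

lemma HasWeakDeriv.add {L : ℝ} {f g f' g' : EdgeL2 L} (h : HasWeakDeriv f g)
    (h' : HasWeakDeriv f' g') : HasWeakDeriv (f + f') (g + g') := by
  intro φ hφ hc hs
  have hd : Continuous (deriv φ) := hφ.continuous_deriv (by simp)
  have e₁ : ∫ x, (f + f') x * deriv φ x ∂(edgeMeasure L)
      = ∫ x, (f x * deriv φ x + f' x * deriv φ x) ∂(edgeMeasure L) :=
    integral_congr_ae (by
      filter_upwards [Lp.coeFn_add f f'] with x hx
      rw [hx, Pi.add_apply, add_mul])
  have e₂ : ∫ x, (g + g') x * φ x ∂(edgeMeasure L)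
      = ∫ x, (g x * φ x + g' x * φ x) ∂(edgeMeasure L) :=
    integral_congr_ae (by
      filter_upwards [Lp.coeFn_add g g'] with x hx
      rw [hx, Pi.add_apply, add_mul])
  rw [e₁, e₂, integral_add (integrable_mul_test f hd hc.deriv) (integrable_mul_test f' hd hc.deriv),
    integral_add (integrable_mul_test g hφ.continuous hc)
      (integrable_mul_test g' hφ.continuous hc), h φ hφ hc hs, h' φ hφ hc hs]
  ring

lemma HasWeakDeriv.smul {L : ℝ} {f g : EdgeL2 L} (a : ℝ) (h : HasWeakDeriv f g) :
    HasWeakDeriv (a • f) (a • g) := by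
  intro φ hφ hc hs
  have e₁ : ∫ x, (a • f) x * deriv φ x ∂(edgeMeasure L)
      = ∫ x, a * (f x * deriv φ x) ∂(edgeMeasure L) :=
    integral_congr_ae (by
      filter_upwards [Lp.coeFn_smul a f] with x hx
      rw [hx, Pi.smul_apply, smul_eq_mul, mul_assoc])
  have e₂ : ∫ x, (a • g) x * φ x ∂(edgeMeasure L)
      = ∫ x, a * (g x * φ x) ∂(edgeMeasure L) :=
    integral_congr_ae (by
      filter_upwards [Lp.coeFn_smul a g] with x hx
      rw [hx, Pi.smul_apply, smul_eq_mul, mul_assoc])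
  rw [e₁, e₂, integral_const_mul, integral_const_mul, h φ hφ hc hs]
  ring

lemma HasTrace.unique {L : ℝ} (hL : 0 < L) {f : EdgeL2 L} {p c c' : ℝ} (hp : p ∈ Icc 0 L)
    (h : HasTrace f p c) (h' : HasTrace f p c') : c = c' := by
  obtain ⟨g, hg, hfg, rfl⟩ := h
  obtain ⟨g', hg', hfg', rfl⟩ := h'
  have hI : Ioo 0 L ⊆ closure (interior (Ioo 0 L)) := by
    rw [interior_Ioo]; exact subset_closure
  have e : EqOn g g' (Ioo 0 L) := Measure.eqOn_of_ae_eq (hfg.symm.trans hfg')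
    (hg.mono Ioo_subset_Icc_self) (hg'.mono Ioo_subset_Icc_self) hI
  exact e.of_subset_closure hg hg' Ioo_subset_Icc_self (by rw [closure_Ioo hL.ne]) hp

lemma HasTrace.zero {L : ℝ} (p : ℝ) : HasTrace (0 : EdgeL2 L) p 0 :=
  ⟨0, continuousOn_const, Lp.coeFn_zero ℝ 2 (edgeMeasure L), rfl⟩

lemma HasTrace.add {L : ℝ} {f f' : EdgeL2 L} {p c c' : ℝ} (h : HasTrace f p c)
    (h' : HasTrace f' p c') : HasTrace (f + f') p (c + c') := by
  obtain ⟨g, hg, hfg, hc⟩ := h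
  obtain ⟨g', hg', hfg', hc'⟩ := h'
  exact ⟨g + g', hg.add hg', (Lp.coeFn_add f f').trans (hfg.add hfg'), by simp [hc, hc']⟩

lemma HasTrace.smul {L : ℝ} {f : EdgeL2 L} {p c : ℝ} (a : ℝ) (h : HasTrace f p c) :
    HasTrace (a • f) p (a • c) := by
  obtain ⟨g, hg, hfg, hc⟩ := h
  exact ⟨a • g, hg.const_smul a, (Lp.coeFn_smul a f).trans (hfg.const_smul a), by simp [hc]⟩

variable {N : ℕ}

/-- The Hilbert sum over the edges of `L²(0, ℓ_j) × L²(0, ℓ_j)`, which holds the pairs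
`(u_j, ∂ₓ u_j)`. -/
abbrev JetSpace (ℓ : Fin N → ℝ) : Type :=
  PiLp 2 fun j : Fin N => WithLp 2 (EdgeL2 (ℓ j) × EdgeL2 (ℓ j))

/-- The energy space `ℍ¹ₑ` of the star network with edges `(0, ℓ_j)`: families `u_j ∈ H¹(0, ℓ_j)`
(recorded together with their weak derivatives) with `u_j(ℓ_j) = 0` and a common value at the
central node `x = 0`. Its inner product is `∑ j, ∫ (u_j v_j + ∂ₓu_j ∂ₓv_j)`. -/
def H1eSubmodule (ℓ : Fin N → ℝ) : Submodule ℝ (JetSpace ℓ) where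
  carrier := {u | (∀ j, HasWeakDeriv (u j).fst (u j).snd) ∧ (∀ j, HasTrace (u j).fst (ℓ j) 0) ∧
    ∃ c : ℝ, ∀ j, HasTrace (u j).fst 0 c}
  zero_mem' := ⟨fun _ => HasWeakDeriv.zero, fun _ => HasTrace.zero _, 0, fun _ => HasTrace.zero _⟩
  add_mem' := by
    rintro u v ⟨hu, hu', c, hc⟩ ⟨hv, hv', d, hd⟩
    exact ⟨fun j => (hu j).add (hv j), fun j => by simpa using (hu' j).add (hv' j),
      c + d, fun j => (hc j).add (hd j)⟩
  smul_mem' := by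
    rintro a u ⟨hu, hu', c, hc⟩
    exact ⟨fun j => (hu j).smul a, fun j => by simpa using (hu' j).smul a,
      a • c, fun j => (hc j).smul a⟩

/-- The energy space `ℍ¹ₑ` as a normed space. -/
abbrev H1e (ℓ : Fin N → ℝ) : Type := H1eSubmodule ℓ

variable {ℓ : Fin N → ℝ}

/-- The component `u_j` on the `j`-th edge. -/
def H1e.comp (u : H1e ℓ) (j : Fin N) : EdgeL2 (ℓ j) := (u.1 j).fst

/-- The weak derivative `∂ₓ u_j` on the `j`-th edge. -/
def H1e.dx (u : H1e ℓ) (j : Fin N) : EdgeL2 (ℓ j) := (u.1 j).snd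

/-- The common value `u_1(0) = ⋯ = u_N(0)` at the central node. -/
def H1e.node (u : H1e ℓ) : ℝ := u.2.2.2.choose

lemma H1e.hasTrace_node (u : H1e ℓ) (j : Fin N) : HasTrace (u.comp j) 0 u.node :=
  u.2.2.2.choose_spec j

lemma H1e.inner_eq (u v : H1e ℓ) :
    inner ℝ u v = ∑ j, ∫ x, (u.comp j x * v.comp j x + u.dx j x * v.dx j x)
      ∂(edgeMeasure (ℓ j)) := by
  have h : ∀ (L : ℝ) (f g : EdgeL2 L), Integrable (fun x => f x * g x) (edgeMeasure L) :=
    fun L f g => (Lp.memLp f).integrable_mul (Lp.memLp g)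
  rw [Submodule.coe_inner, PiLp.inner_apply]
  refine Finset.sum_congr rfl fun j _ => ?_
  rw [integral_add (h _ _ _) (h _ _ _), WithLp.prod_inner_apply, L2.inner_def, L2.inner_def]
  simp only [RCLike.inner_apply, conj_trivial]
  simp only [H1e.comp, H1e.dx, mul_comm]
  rfl

/-- `u ∈ C([0,∞), ℍ¹ₑ)` solves the nonlinear system with initial datum `u₀`: at each `t > 0` it has
a time derivative `v = ∂ₜu(t)` in `ℍ¹ₑ` with `v_j ∈ H²(0, ℓ_j)` (`w_j` is `∂ₓ²v_j`, and `d_j` is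
`∂ₓv_j(0)`), the equation holds almost everywhere on every edge, and the flux condition holds at
the central node. Continuity at the node and the Dirichlet conditions are part of `ℍ¹ₑ`. -/
def IsSolution (α : ℝ) (u₀ : H1e ℓ) (u : C(ℝ≥0, H1e ℓ)) : Prop :=
  u 0 = u₀ ∧
  ∀ t : ℝ, 0 < t → ∃ v : H1e ℓ, HasDerivAt (fun s : ℝ => u s.toNNReal) v t ∧
    ∃ (w : ∀ j, EdgeL2 (ℓ j)) (d : Fin N → ℝ),
      (∀ j, HasWeakDeriv (v.dx j) (w j)) ∧
      (∀ j, HasTrace (v.dx j) 0 (d j)) ∧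
      (∀ j, ∀ᵐ x ∂(edgeMeasure (ℓ j)),
        v.comp j x - w j x + (u t.toNNReal).dx j x
          + (u t.toNNReal).comp j x * (u t.toNNReal).dx j x = 0) ∧
      ∑ j, d j = α * (u t.toNNReal).node + (N : ℝ) / 3 * (u t.toNNReal).node ^ 2

/-- The weak (variational, integrated in time) form of the same system, which makes sense for every
`u ∈ C([0,∞), ℍ¹ₑ)`: the flux condition is the natural boundary condition at the node. -/
def IsWeakSolution (α : ℝ) (u₀ : H1e ℓ) (u : C(ℝ≥0, H1e ℓ)) : Prop :=
  ∀ (φ : H1e ℓ) (t : ℝ≥0),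
    inner ℝ (u t) φ = inner ℝ u₀ φ - ∫ s in (0 : ℝ)..t,
      ((∑ j, ∫ x, ((u s.toNNReal).dx j x + (u s.toNNReal).comp j x * (u s.toNNReal).dx j x)
          * φ.comp j x ∂(edgeMeasure (ℓ j)))
        + (α * (u s.toNNReal).node + (N : ℝ) / 3 * (u s.toNNReal).node ^ 2) * φ.node)

end

end StarBBM

/-! Tested against `φ` and integrated by parts in space, the system becomes an ordinary differential
equation in ℍ¹ₑ. For fixed `u` the functional `weakForm α u` is bounded on ℍ¹ₑ, so it is represented
by a vector: `⟨F u, φ⟩ = -weakForm α u φ` (`exists_vectorField`). Since H¹ of an edge embeds in L^∞,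
the product `u ∂ₓu` is a bounded quadratic map into L², hence `F` is Lipschitz on balls.

Both notions of solution are the integrated equation `IsMild F u₀ u`. For weak solutions this is
testing against all `φ` (`isWeakSolution_iff_isMild`). For strong ones, Green's formula and the
choice of test functions show that `v` satisfies the strong form at `u` exactly when `v = F u`
(`StrongForm.inner_eq`, `strongForm_of_inner_eq`). Thus the two notions coincide, and uniqueness is
Gronwall's (`IsMild.unique`).

Global existence rests on `weakForm_self`: `⟨F u, u⟩ = -(α - N/2) u(0)² ≤ 0`, where the coefficient
`N/3` in the flux condition cancels the cubic terms. The norm therefore cannot grow, and truncating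
`F` outside a ball larger than the datum does not affect the solution (`exists_isMild`).

All this needs absolutely continuous representatives of functions with a weak derivative
(`HasWeakDeriv.exists_acRep`) and completeness of ℍ¹ₑ (`isClosed_H1eSubmodule`). -/

namespace StarBBM

noncomputable section

/-! ### Sobolev functions on a single edge -/

/-- `F` is an absolutely continuous representative on `[0, L]` of `f`, with derivative `g`. -/
structure ACRep {L : ℝ} (F : ℝ → ℝ) (f g : EdgeL2 L) : Prop where
  ac : AbsolutelyContinuousOnInterval F 0 L
  ae_eq : f =ᵐ[edgeMeasure L] F
  deriv_ae_eq : deriv F =ᵐ[edgeMeasure L] g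

lemma integrable_edge {L : ℝ} (f : EdgeL2 L) : Integrable f (edgeMeasure L) :=
  (Lp.memLp f).integrable (by norm_num)

lemma integrable_edge_mul {L : ℝ} (f g : EdgeL2 L) :
    Integrable (fun x => f x * g x) (edgeMeasure L) :=
  (Lp.memLp f).integrable_mul (Lp.memLp g)

lemma intervalIntegral_eq_edge {L : ℝ} (hL : 0 < L) (f : ℝ → ℝ) :
    ∫ x in (0 : ℝ)..L, f x = ∫ x, f x ∂(edgeMeasure L) := by
  rw [intervalIntegral.integral_of_le hL.le, integral_Ioc_eq_integral_Ioo]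

lemma intervalIntegrable_edge {L : ℝ} (hL : 0 < L) (f : EdgeL2 L) :
    IntervalIntegrable f volume 0 L := by
  rw [intervalIntegrable_iff_integrableOn_Ioo_of_le hL.le]
  exact integrable_edge f

lemma ae_edge_of_ae_uIcc {L : ℝ} (hL : 0 < L) {p : ℝ → Prop} (h : ∀ᵐ x, x ∈ uIcc 0 L → p x) :
    ∀ᵐ x ∂(edgeMeasure L), p x := by
  rw [ae_restrict_iff' measurableSet_Ioo]
  filter_upwards [h] with x hx hx'
  exact hx (by rw [uIcc_of_le hL.le]; exact Ioo_subset_Icc_self hx')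

/-- Integration by parts on an edge. -/
lemma ACRep.integral_add {L : ℝ} (hL : 0 < L) {F H : ℝ → ℝ} {f g h k : EdgeL2 L}
    (hF : ACRep F f g) (hH : ACRep H h k) :
    ∫ x, (f x * k x + g x * h x) ∂(edgeMeasure L) = F L * H L - F 0 * H 0 := by
  rw [← hF.ac.integral_deriv_mul_eq_sub hH.ac, intervalIntegral_eq_edge hL]
  refine integral_congr_ae ?_
  filter_upwards [hF.ae_eq, hH.ae_eq, hF.deriv_ae_eq, hH.deriv_ae_eq] with x h1 h2 h3 h4
  rw [h1, h2, h3, h4]; ring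

lemma ACRep.hasTrace {L : ℝ} (hL : 0 < L) {F : ℝ → ℝ} {f g : EdgeL2 L} (hF : ACRep F f g) (p : ℝ) :
    HasTrace f p (F p) :=
  ⟨F, by simpa [uIcc_of_le hL.le] using hF.ac.continuousOn, hF.ae_eq, rfl⟩

lemma ACRep.eq_of_hasTrace {L : ℝ} (hL : 0 < L) {F : ℝ → ℝ} {f g : EdgeL2 L} (hF : ACRep F f g)
    {p c : ℝ} (hp : p ∈ Icc 0 L) (h : HasTrace f p c) : F p = c :=
  (hF.hasTrace hL p).unique hL hp h

/-- The class in `L²(0, L)` of a continuous function. -/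
def edgeOfContinuous (L : ℝ) {φ : ℝ → ℝ} (hφ : Continuous φ) : EdgeL2 L :=
  MemLp.toLp φ (by
    have h : MemLp φ 2 (volume.restrict (Icc 0 L)) :=
      MemLp.of_bound hφ.aestronglyMeasurable
        (isCompact_Icc.exists_bound_of_continuousOn (s := Icc 0 L) hφ.continuousOn).choose
        ((ae_restrict_iff' measurableSet_Icc).2 (ae_of_all _
        (isCompact_Icc.exists_bound_of_continuousOn (s := Icc 0 L) hφ.continuousOn).choose_spec))
    exact h.mono_measure (Measure.restrict_mono_set _ Ioo_subset_Icc_self))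

lemma coeFn_edgeOfContinuous (L : ℝ) {φ : ℝ → ℝ} (hφ : Continuous φ) :
    edgeOfContinuous L hφ =ᵐ[edgeMeasure L] φ := MemLp.coeFn_toLp _

lemma acRep_of_contDiff (L : ℝ) {φ : ℝ → ℝ} (hφ : ContDiff ℝ 1 φ) :
    ACRep φ (edgeOfContinuous L hφ.continuous)
      (edgeOfContinuous L (hφ.continuous_deriv le_rfl)) :=
  ⟨hφ.contDiffOn.absolutelyContinuousOnInterval, coeFn_edgeOfContinuous L _,
    (coeFn_edgeOfContinuous L _).symm⟩

/-- Integration by parts against a test function; the boundary terms vanish because its support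
avoids both end points. -/
lemma ACRep.hasWeakDeriv {L : ℝ} (hL : 0 < L) {F : ℝ → ℝ} {f g : EdgeL2 L} (hF : ACRep F f g) :
    HasWeakDeriv f g := by
  intro φ hφ hc hs
  have hφ1 : ContDiff ℝ 1 φ := hφ.of_le (by simp)
  have h := hF.integral_add hL (acRep_of_contDiff L hφ1)
  have h0 : φ 0 = 0 := by
    by_contra h0
    exact absurd (hs (subset_tsupport φ h0)).1 (lt_irrefl _)
  have h1 : φ L = 0 := by
    by_contra h0
    exact absurd (hs (subset_tsupport φ h0)).2 (lt_irrefl _)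
  rw [h0, h1, MeasureTheory.integral_add (integrable_edge_mul _ _) (integrable_edge_mul _ _)] at h
  have e1 : ∫ x, f x * deriv φ x ∂(edgeMeasure L)
      = ∫ x, f x * edgeOfContinuous L (hφ1.continuous_deriv le_rfl) x ∂(edgeMeasure L) :=
    integral_congr_ae (by
      filter_upwards [coeFn_edgeOfContinuous L (hφ1.continuous_deriv le_rfl)] with x hx
      rw [hx])
  have e2 : ∫ x, g x * φ x ∂(edgeMeasure L)
      = ∫ x, g x * edgeOfContinuous L hφ1.continuous x ∂(edgeMeasure L) :=
    integral_congr_ae (by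
      filter_upwards [coeFn_edgeOfContinuous L hφ1.continuous] with x hx
      rw [hx])
  rw [e1, e2]; linarith

/-- The primitive of an `L²` function. -/
lemma exists_acRep_primitive {L : ℝ} (hL : 0 < L) (g : EdgeL2 L) :
    ∃ (F : ℝ → ℝ) (f : EdgeL2 L), ACRep F f g := by
  have hi := intervalIntegrable_edge hL g
  have hac : AbsolutelyContinuousOnInterval (fun x => ∫ y in (0 : ℝ)..x, g y) 0 L :=
    hi.absolutelyContinuousOnInterval_intervalIntegral (by simp)
  have hcont : ContinuousOn (fun x => ∫ y in (0 : ℝ)..x, g y) (Icc 0 L) := by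
    simpa [uIcc_of_le hL.le] using hac.continuousOn
  obtain ⟨C, hC⟩ := isCompact_Icc.exists_bound_of_continuousOn hcont
  have hm : MemLp (fun x => ∫ y in (0 : ℝ)..x, g y) 2 (edgeMeasure L) :=
    MemLp.of_bound ((hcont.mono Ioo_subset_Icc_self).aestronglyMeasurable measurableSet_Ioo) C
      ((ae_restrict_iff' measurableSet_Ioo).2 (ae_of_all _ fun x hx =>
        hC x (Ioo_subset_Icc_self hx)))
  refine ⟨_, hm.toLp, hac, hm.coeFn_toLp, ?_⟩
  refine ae_edge_of_ae_uIcc hL ?_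
  filter_upwards [hi.ae_hasDerivAt_integral] with x hx hx'
  exact (hx hx' 0 (by simp)).deriv

/-- A smooth function with integral zero and compact support in `(0, L)` is the derivative of a
smooth function with compact support in `(0, L)`. -/
lemma exists_test_primitive {L : ℝ} (hL : 0 < L) {ψ : ℝ → ℝ} (hψ : ContDiff ℝ ∞ ψ)
    (hc : HasCompactSupport ψ) (hs : tsupport ψ ⊆ Ioo 0 L)
    (h0 : ∫ x, ψ x ∂(edgeMeasure L) = 0) :
    ∃ φ : ℝ → ℝ, ContDiff ℝ ∞ φ ∧ HasCompactSupport φ ∧ tsupport φ ⊆ Ioo 0 L ∧ deriv φ = ψ := by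
  obtain ⟨a, b, ha, hb, hab⟩ : ∃ a b : ℝ, 0 < a ∧ b < L ∧ tsupport ψ ⊆ Icc a b := by
    rcases (tsupport ψ).eq_empty_or_nonempty with he | hne
    -- With empty support any empty `Icc a b` will do; `a = L`, `b = 0` also meets `0 < a` and `b <
    -- L`.
    · exact ⟨L, 0, hL, hL, by simp [he]⟩
    · have hK : IsCompact (tsupport ψ) := hc
      exact ⟨_, _, (hs (hK.sInf_mem hne)).1, (hs (hK.sSup_mem hne)).2,
        fun x hx => ⟨csInf_le hK.bddBelow hx, le_csSup hK.bddAbove hx⟩⟩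
  have hz : ∀ x, x ∉ Icc a b → ψ x = 0 := fun x hx =>
    image_eq_zero_of_notMem_tsupport fun h' => hx (hab h')
  have hd : ∀ x, HasDerivAt (fun x => ∫ y in (0 : ℝ)..x, ψ y) (ψ x) x := fun x =>
    hψ.continuous.integral_hasStrictDerivAt 0 x |>.hasDerivAt
  have hd' : deriv (fun x => ∫ y in (0 : ℝ)..x, ψ y) = ψ := funext fun x => (hd x).deriv
  have hsupp : ∀ x, x ∉ Icc a b → ∫ y in (0 : ℝ)..x, ψ y = 0 := by
    intro x hx
    by_cases hxa : x < a
    · refine intervalIntegral.integral_zero_ae (ae_of_all _ fun y hy => hz y fun hy' => ?_)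
      have := (uIoc_subset_uIcc hy)
      rw [mem_uIcc] at this
      rcases this with h | h <;> linarith [h.1, h.2, hy'.1]
    · have hxb : b < x := by
        by_contra h; exact hx ⟨not_lt.1 hxa, not_lt.1 h⟩
      have e1 : ∫ y in (0 : ℝ)..L, ψ y = 0 := by rw [intervalIntegral_eq_edge hL, h0]
      have e2 : ∫ y in L..x, ψ y = 0 := by
        refine intervalIntegral.integral_zero_ae (ae_of_all _ fun y hy => hz y fun hy' => ?_)
        have := (uIoc_subset_uIcc hy)
        rw [mem_uIcc] at this
        rcases this with h | h <;> linarith [h.1, h.2, hy'.2]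
      rw [← intervalIntegral.integral_add_adjacent_intervals
        (hψ.continuous.intervalIntegrable 0 L) (hψ.continuous.intervalIntegrable L x), e1, e2,
        add_zero]
  refine ⟨fun x => ∫ y in (0 : ℝ)..x, ψ y, ?_, ?_, ?_, hd'⟩
  · rw [contDiff_infty_iff_deriv]
    exact ⟨fun x => (hd x).differentiableAt, by rw [hd']; exact hψ⟩
  · exact HasCompactSupport.intro isCompact_Icc hsupp
  · refine (closure_minimal (fun x hx => ?_) isClosed_Icc).trans (Icc_subset_Ioo ha hb)
    by_contra h
    exact hx (hsupp x h)

/-- A function with vanishing weak derivative is constant. -/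
lemma HasWeakDeriv.ae_const {L : ℝ} (hL : 0 < L) {f : EdgeL2 L} (h : HasWeakDeriv f 0) :
    ∃ c : ℝ, f =ᵐ[edgeMeasure L] fun _ => c := by
  -- A bump of unit mass centred at the midpoint, with support well inside `(0, L)`; the constant
  -- will be the mean of `f` against it.
  obtain ⟨b, hb⟩ : ∃ b : ContDiffBump (L / 2), b.rOut < L / 2 :=
    ⟨⟨L / 8, L / 4, by positivity, by linarith⟩, by simp; linarith⟩
  set ψ₀ : ℝ → ℝ := b.normed volume with hψ₀
  have hψd : ContDiff ℝ ∞ ψ₀ := b.contDiff_normed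
  have hψc : HasCompactSupport ψ₀ := b.hasCompactSupport_normed
  have hψs : tsupport ψ₀ ⊆ Ioo 0 L := by
    rw [b.tsupport_normed_eq, Real.closedBall_eq_Icc]
    exact Icc_subset_Ioo (by linarith) (by linarith)
  have hint : ∀ χ : ℝ → ℝ, tsupport χ ⊆ Ioo 0 L →
      ∫ x, χ x ∂(edgeMeasure L) = ∫ x, χ x := fun χ hχ =>
    setIntegral_eq_integral_of_forall_compl_eq_zero fun x hx =>
      image_eq_zero_of_notMem_tsupport fun h' => hx (hχ h')
  have hψi : ∫ x, ψ₀ x ∂(edgeMeasure L) = 1 := by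
    rw [hint _ hψs]; exact b.integral_normed
  set c := ∫ x, f x * ψ₀ x ∂(edgeMeasure L) with hcdef
  refine ⟨c, ?_⟩
  have key := isOpen_Ioo (a := (0:ℝ)) (b := L) |>.ae_eq_zero_of_integral_contDiff_smul_eq_zero
    (f := fun x => f x - c) (μ := edgeMeasure L) ?_ ?_
  · have hm : ∀ᵐ x ∂(edgeMeasure L), x ∈ Ioo 0 L := ae_restrict_mem measurableSet_Ioo
    filter_upwards [key, hm] with x hx hx'
    linarith [hx hx']
  · exact (((integrable_edge f).sub (integrable_const c)).locallyIntegrable).locallyIntegrableOn _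
  · intro χ hχ hχc hχs
    set m := ∫ x, χ x ∂(edgeMeasure L) with hm
    have iχ : Integrable χ (edgeMeasure L) :=
      (hχ.continuous.integrable_of_hasCompactSupport hχc).restrict
    have iψ : Integrable ψ₀ (edgeMeasure L) :=
      (hψd.continuous.integrable_of_hasCompactSupport hψc).restrict
    -- Removing the mass of `χ` with a multiple of `ψ₀` leaves a function of integral zero, hence
    -- the derivative of an admissible test function (du Bois-Reymond).
    obtain ⟨φ, hφ, hφc, hφs, hφd⟩ := exists_test_primitive hL (ψ := fun x => χ x - m * ψ₀ x)
      (hχ.sub (contDiff_const.mul hψd)) (hχc.sub (hψc.mul_left))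
      ((tsupport_sub _ _).trans (union_subset hχs
        ((tsupport_mul_subset_right (f := fun _ => m)).trans hψs)))
      (by rw [integral_sub iχ (iψ.const_mul m), integral_const_mul, hψi, ← hm]; ring)
    have := h φ hφ hφc hφs
    rw [hφd] at this
    have z : ∫ x, (0 : EdgeL2 L) x * φ x ∂(edgeMeasure L) = 0 :=
      integral_eq_zero_of_ae (by
        filter_upwards [Lp.coeFn_zero ℝ 2 (edgeMeasure L)] with x hx
        rw [hx]; simp)
    have i1 := integrable_mul_test f hχ.continuous hχc
    have i2 := integrable_mul_test f hψd.continuous hψc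
    have e : ∀ x, f x * (χ x - m * ψ₀ x) = f x * χ x - m * (f x * ψ₀ x) := fun x => by ring
    simp_rw [e] at this
    rw [z, integral_sub i1 (i2.const_mul m), integral_const_mul, ← hcdef] at this
    have e' : ∀ x, χ x • (f x - c) = f x * χ x - c * χ x := fun x => by simp; ring
    simp_rw [e']
    rw [integral_sub i1 (iχ.const_mul c), integral_const_mul, ← hm]
    linarith

/-- Subtracting a primitive of `g` leaves a function with zero weak derivative, hence a constant. -/
lemma HasWeakDeriv.exists_acRep {L : ℝ} (hL : 0 < L) {f g : EdgeL2 L} (h : HasWeakDeriv f g) :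
    ∃ F, ACRep F f g := by
  obtain ⟨G, k, hG⟩ := exists_acRep_primitive hL g
  have h' : HasWeakDeriv (f - k) 0 := by
    have := h.add ((hG.hasWeakDeriv hL).smul (-1))
    simpa [sub_eq_add_neg] using this
  obtain ⟨c, hc⟩ := h'.ae_const hL
  refine ⟨fun x => G x + c, ?_, ?_, ?_⟩
  · exact hG.ac.add (contDiff_const.contDiffOn.absolutelyContinuousOnInterval)
  · filter_upwards [hc, hG.ae_eq, Lp.coeFn_sub f k] with x h1 h2 h3
    rw [h3, Pi.sub_apply] at h1
    linarith
  · simpa [deriv_add_const'] using hG.deriv_ae_eq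

/-- As `F` vanishes at `L`, `F x` is minus the integral of `F'` over `[x, L]`. With
`integral_abs_le_norm` this is the embedding of H¹ into L^∞. -/
lemma ACRep.abs_le {L : ℝ} (hL : 0 < L) {F : ℝ → ℝ} {f g : EdgeL2 L} (hF : ACRep F f g)
    (h0 : F L = 0) {x : ℝ} (hx : x ∈ Icc 0 L) : |F x| ≤ ∫ y, |g y| ∂(edgeMeasure L) := by
  have hsub : uIcc x L ⊆ uIcc 0 L := by
    rw [uIcc_of_le hx.2, uIcc_of_le hL.le]; exact Icc_subset_Icc_left hx.1
  have h1 := (hF.ac.mono hsub).integral_deriv_eq_sub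
  rw [h0, zero_sub] at h1
  rw [← abs_neg, ← h1]
  have i := hF.ac.intervalIntegrable_deriv
  calc |∫ y in x..L, deriv F y| ≤ ∫ y in x..L, |deriv F y| :=
        intervalIntegral.abs_integral_le_integral_abs hx.2
    _ ≤ ∫ y in (0 : ℝ)..L, |deriv F y| :=
        intervalIntegral.integral_mono_interval hx.1 hx.2 le_rfl
          (ae_of_all _ fun _ => abs_nonneg _) i.abs
    _ = ∫ y, |g y| ∂(edgeMeasure L) := by
        rw [intervalIntegral_eq_edge hL]
        refine integral_congr_ae ?_
        filter_upwards [hF.deriv_ae_eq] with y hy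
        rw [hy]

lemma integral_abs_le_norm {L : ℝ} (g : EdgeL2 L) :
    ∫ y, |g y| ∂(edgeMeasure L) ≤
      ‖edgeOfContinuous L (continuous_const (y := (1 : ℝ)))‖ * ‖g‖ := by
  have h := real_inner_le_norm (edgeOfContinuous L (continuous_const (y := (1 : ℝ)))) |g|
  rw [norm_abs_eq_norm, L2.inner_def] at h
  refine le_trans (le_of_eq (integral_congr_ae ?_)) h
  filter_upwards [coeFn_edgeOfContinuous L (continuous_const (y := (1 : ℝ))),
    Lp.coeFn_abs g] with x h1 h2
  simp [h1, h2]

/-! ### Global flows of dissipative vector fields that are Lipschitz on balls -/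

section Abstract

open Metric Filter Topology

variable {H G G' : Type*} [NormedAddCommGroup H] [NormedAddCommGroup G] [NormedAddCommGroup G']

/-- `F` is Lipschitz on every ball centred at the origin. -/
def LipschitzOnBalls (F : H → G) : Prop :=
  ∀ R : ℝ, ∃ K : ℝ≥0, LipschitzOnWith K F (closedBall 0 R)

lemma LipschitzOnBalls.continuous {F : H → G} (hF : LipschitzOnBalls F) : Continuous F := by
  rw [continuous_iff_continuousAt]
  intro x
  obtain ⟨K, hK⟩ := hF (‖x‖ + 1)
  refine hK.continuousOn.continuousAt ?_
  refine mem_of_superset (closedBall_mem_nhds x one_pos) fun y hy => ?_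
  rw [mem_closedBall, dist_eq_norm] at hy
  rw [mem_closedBall_zero_iff]
  linarith [norm_sub_norm_le y x]

lemma LipschitzOnBalls.add {F F' : H → G} (hF : LipschitzOnBalls F) (hF' : LipschitzOnBalls F') :
    LipschitzOnBalls fun x => F x + F' x := fun R => by
  obtain ⟨K, hK⟩ := hF R
  obtain ⟨K', hK'⟩ := hF' R
  exact ⟨K + K', hK.add hK'⟩

lemma LipschitzOnBalls.neg {F : H → G} (hF : LipschitzOnBalls F) :
    LipschitzOnBalls fun x => -F x := fun R => by
  obtain ⟨K, hK⟩ := hF R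
  exact ⟨K, hK.neg⟩

lemma LipschitzOnBalls.sum {ι : Type*} (s : Finset ι) {F : ι → H → G}
    (hF : ∀ i, LipschitzOnBalls (F i)) : LipschitzOnBalls fun x => ∑ i ∈ s, F i x := by
  classical
  induction s using Finset.induction_on with
  | empty => exact fun R => ⟨0, by simp⟩
  | insert i s hi ih =>
    simp_rw [Finset.sum_insert hi]
    exact (hF i).add ih

section Linear

variable [NormedSpace ℝ G] [NormedSpace ℝ G']

lemma LipschitzOnBalls.clm_comp (T : G →L[ℝ] G') {F : H → G} (hF : LipschitzOnBalls F) :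
    LipschitzOnBalls fun x => T (F x) := fun R => by
  obtain ⟨K, hK⟩ := hF R
  exact ⟨_, T.lipschitz.comp_lipschitzOnWith hK⟩

variable [NormedSpace ℝ H]

lemma lipschitzOnBalls_clm (T : H →L[ℝ] G) : LipschitzOnBalls T :=
  fun _ => ⟨_, T.lipschitz.lipschitzOnWith⟩

/-- Both nonlinearities, `u ∂ₓu` and the squared node value, have this shape. -/
lemma lipschitzOnBalls_bilin (B : H →L[ℝ] G →L[ℝ] G') (T : H →L[ℝ] G) :
    LipschitzOnBalls fun x => B x (T x) := fun R => by
  refine ⟨‖B‖₊ * ‖T‖₊ * (2 * R.toNNReal), LipschitzOnWith.of_dist_le_mul fun x hx y hy => ?_⟩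
  rw [mem_closedBall_zero_iff] at hx hy
  rw [dist_eq_norm, dist_eq_norm]
  have e : B x (T x) - B y (T y) = B (x - y) (T x) + B y (T (x - y)) := by
    simp only [map_sub, sub_apply]; abel
  have hR : 0 ≤ R := (norm_nonneg x).trans hx
  have h1 : ‖B (x - y) (T x)‖ ≤ ‖B‖ * ‖x - y‖ * (‖T‖ * R) :=
    (B.le_opNorm₂ _ _).trans (by gcongr; exact (T.le_opNorm _).trans (by gcongr))
  have h2 : ‖B y (T (x - y))‖ ≤ ‖B‖ * R * (‖T‖ * ‖x - y‖) :=
    (B.le_opNorm₂ _ _).trans (by gcongr; exact T.le_opNorm _)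
  rw [e]
  refine (norm_add_le _ _).trans ((add_le_add h1 h2).trans (le_of_eq ?_))
  simp only [NNReal.coe_mul, coe_nnnorm, NNReal.coe_ofNat, Real.coe_toNNReal R hR]
  ring

end Linear

variable [InnerProductSpace ℝ H]

/-- `u` solves `u' = F(u)`, `u(0) = u₀` in integrated form. -/
def IsMild (F : H → H) (u₀ : H) (u : C(ℝ≥0, H)) : Prop :=
  ∀ t : ℝ≥0, u t = u₀ + ∫ s in (0 : ℝ)..t, F (u s.toNNReal)

/-- Only a one-sided derivative can be claimed at `t = 0`, since `s.toNNReal` freezes the path for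
negative `s`. -/
lemma IsMild.hasDerivWithinAt [CompleteSpace H] {F : H → H} (hF : Continuous F) {u₀ : H}
    {u : C(ℝ≥0, H)} (h : IsMild F u₀ u) {t : ℝ} (ht : 0 ≤ t) :
    HasDerivWithinAt (fun s : ℝ => u s.toNNReal) (F (u t.toNNReal)) (Ici 0) t := by
  have hc : Continuous fun s : ℝ => F (u s.toNNReal) := by fun_prop
  have hd := ((hc.integral_hasStrictDerivAt 0 t).hasDerivAt.const_add u₀).hasDerivWithinAt
    (s := Ici 0)
  refine hd.congr (fun s hs => ?_) ?_
  · rw [h s.toNNReal, Real.coe_toNNReal s hs]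
  · rw [h t.toNNReal, Real.coe_toNNReal t ht]

lemma IsMild.hasDerivAt [CompleteSpace H] {F : H → H} (hF : Continuous F) {u₀ : H}
    {u : C(ℝ≥0, H)} (h : IsMild F u₀ u) {t : ℝ} (ht : 0 < t) :
    HasDerivAt (fun s : ℝ => u s.toNNReal) (F (u t.toNNReal)) t :=
  (h.hasDerivWithinAt hF ht.le).hasDerivAt (Ici_mem_nhds ht)

lemma IsMild.apply_zero {F : H → H} {u₀ : H} {u : C(ℝ≥0, H)} (h : IsMild F u₀ u) : u 0 = u₀ := by
  simpa using h 0

lemma isMild_of_hasDerivAt [CompleteSpace H] {F : H → H} (hF : Continuous F) {u₀ : H}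
    {u : C(ℝ≥0, H)} (h0 : u 0 = u₀)
    (h : ∀ t : ℝ, 0 < t → HasDerivAt (fun s : ℝ => u s.toNNReal) (F (u t.toNNReal)) t) :
    IsMild F u₀ u := by
  intro t
  have hc : Continuous fun s : ℝ => F (u s.toNNReal) := by fun_prop
  have hu : Continuous fun s : ℝ => u s.toNNReal := by fun_prop
  have e := intervalIntegral.integral_eq_sub_of_hasDerivAt_of_le (NNReal.coe_nonneg t)
    hu.continuousOn (fun s hs => h s hs.1) (hc.intervalIntegrable _ _)
  simp only [Real.toNNReal_coe, Real.toNNReal_zero, h0] at e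
  exact (by rw [e]; abel : u t = u₀ + ∫ s in (0 : ℝ)..t, F (u s.toNNReal))

/-- On `[0, t]` both paths are bounded by compactness, so they stay in one ball, where `F` has a
single Lipschitz constant. -/
lemma IsMild.unique [CompleteSpace H] {F : H → H} (hF : LipschitzOnBalls F) {u₀ : H}
    {u v : C(ℝ≥0, H)} (hu : IsMild F u₀ u) (hv : IsMild F u₀ v) : u = v := by
  ext t
  have cu : Continuous fun s : ℝ => u s.toNNReal := by fun_prop
  have cv : Continuous fun s : ℝ => v s.toNNReal := by fun_prop
  obtain ⟨A, hA⟩ := isCompact_Icc.exists_bound_of_continuousOn (s := Icc 0 (t : ℝ)) cu.continuousOn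
  obtain ⟨B, hB⟩ := isCompact_Icc.exists_bound_of_continuousOn (s := Icc 0 (t : ℝ)) cv.continuousOn
  obtain ⟨K, hK⟩ := hF (max A B)
  have key := ODE_solution_unique_of_mem_Icc_right (v := fun _ => F)
    (s := fun _ => closedBall (0 : H) (max A B)) (a := 0) (b := (t : ℝ))
    (fun _ _ => hK) cu.continuousOn
    (fun s hs => (hu.hasDerivWithinAt hF.continuous hs.1).mono (Ici_subset_Ici.2 hs.1))
    (fun s hs => mem_closedBall_zero_iff.2 ((hA s (Ico_subset_Icc_self hs)).trans (le_max_left _ _)))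
    cv.continuousOn
    (fun s hs => (hv.hasDerivWithinAt hF.continuous hs.1).mono (Ici_subset_Ici.2 hs.1))
    (fun s hs => mem_closedBall_zero_iff.2 ((hB s (Ico_subset_Icc_self hs)).trans (le_max_right _ _)))
    (by simp [hu.apply_zero, hv.apply_zero])
  simpa using key (right_mem_Icc.2 t.2)

/-- A bounded, globally Lipschitz vector field has global integral curves. -/
lemma exists_global_of_bounded_lipschitz [CompleteSpace H] {G : H → H} {K : ℝ≥0}
    (hG : LipschitzWith K G) {M : ℝ≥0} (hM : ∀ x, ‖G x‖ ≤ M) (u₀ : H) :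
    ∃ u : ℝ → H, u 0 = u₀ ∧ ∀ t, HasDerivAt u (G (u t)) t := by
  have hloc : ∀ n : ℕ, ∃ a : ℝ → H, a 0 = u₀ ∧
      ∀ t ∈ Ioo (-(n + 1 : ℝ)) (n + 1), HasDerivAt a (G (a t)) t := by
    intro n
    have hn : (0 : ℝ) < n + 1 := by positivity
    -- The bound `M` holds everywhere, so the ball may be as large as wished; radius `M * (n + 1)`
    -- is what a path of speed at most `M` can cover in time `n + 1`.
    have hp : IsPicardLindelof (fun _ : ℝ => G) (tmin := -(n + 1 : ℝ)) (tmax := n + 1)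
        ⟨0, by constructor <;> linarith⟩ u₀ (M * (n + 1)) 0 M K :=
      { lipschitzOnWith := fun _ _ => hG.lipschitzOnWith
        continuousOn := fun _ _ => continuousOn_const
        norm_le := fun _ _ x _ => hM x
        mul_max_le := by simp }
    obtain ⟨a, ha, had⟩ := hp.exists_eq_forall_mem_Icc_hasDerivWithinAt₀
    exact ⟨a, ha, fun t ht => (had t (Ioo_subset_Icc_self ht)).hasDerivAt (Icc_mem_nhds ht.1 ht.2)⟩
  choose a ha0 had using hloc
  have hle : ∀ n m : ℕ, n ≤ m → ∀ s ∈ Ioo (-(n + 1 : ℝ)) (n + 1), a n s = a m s := by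
    intro n m hnm
    have hn : (0 : ℝ) < n + 1 := by positivity
    have hnm' : (n : ℝ) ≤ m := by exact_mod_cast hnm
    refine ODE_solution_unique_of_mem_Ioo (v := fun _ => G) (s := fun _ => univ) (t₀ := 0)
      (K := K) (fun _ _ => hG.lipschitzOnWith) (by constructor <;> linarith)
      (fun t ht => ⟨had n t ht, trivial⟩)
      (fun t ht => ⟨had m t ⟨?_, ?_⟩, trivial⟩) ((ha0 n).trans (ha0 m).symm)
    · linarith [ht.1]
    · linarith [ht.2]
  have hmem : ∀ s : ℝ, s ∈ Ioo (-((⌈|s|⌉₊ : ℝ) + 1)) (⌈|s|⌉₊ + 1) := fun s => by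
    have h1 := Nat.le_ceil |s|
    rw [mem_Ioo, ← abs_lt]
    linarith
  -- Local solutions agree on common intervals, so at time `t` any index whose interval contains `t`
  -- may be used.
  refine ⟨fun t => a ⌈|t|⌉₊ t, by simp [ha0], fun t => ?_⟩
  have hev : (fun s => a ⌈|s|⌉₊ s) =ᶠ[𝓝 t] a ⌈|t|⌉₊ := by
    filter_upwards [Ioo_mem_nhds (hmem t).1 (hmem t).2] with s hs
    rcases le_total ⌈|s|⌉₊ ⌈|t|⌉₊ with h | h
    · exact hle _ _ h s (hmem s)
    · exact (hle _ _ h s hs).symm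
  exact (had _ t (hmem t)).congr_of_eventuallyEq hev

/-- The radial retraction onto the ball of radius `R`. -/
def radialRetract (R : ℝ) (x : H) : H := (R / max R ‖x‖) • x

lemma norm_radialRetract_le {R : ℝ} (hR : 0 < R) (x : H) : ‖radialRetract R x‖ ≤ R := by
  have hm : 0 < max R ‖x‖ := lt_max_of_lt_left hR
  rw [radialRetract, norm_smul, Real.norm_of_nonneg (by positivity), div_mul_eq_mul_div,
    div_le_iff₀ hm]
  exact mul_le_mul_of_nonneg_left (le_max_right _ _) hR.le

lemma radialRetract_of_norm_le {R : ℝ} (hR : 0 < R) {x : H} (hx : ‖x‖ ≤ R) :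
    radialRetract R x = x := by
  rw [radialRetract, max_eq_left hx, div_self hR.ne', one_smul]

/-- The difference splits into a multiple of `x - y` and a multiple of `y` whose size is controlled
by `‖x‖ - ‖y‖`; each contributes Lipschitz constant 1. -/
lemma lipschitzWith_radialRetract {R : ℝ} (hR : 0 < R) :
    LipschitzWith 2 (radialRetract R : H → H) := by
  refine LipschitzWith.of_dist_le_mul fun x y => ?_
  rw [dist_eq_norm, dist_eq_norm]
  set a := max R ‖x‖ with ha
  set b := max R ‖y‖ with hb
  have ha0 : 0 < a := lt_max_of_lt_left hR
  have hb0 : 0 < b := lt_max_of_lt_left hR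
  have e : radialRetract R x - radialRetract R y
      = (R / a) • (x - y) + (R * (b - a) / (a * b)) • y := by
    have : R * (b - a) / (a * b) = R / a - R / b := by field_simp
    simp only [radialRetract, ← ha, ← hb, this]
    module
  have hab : |b - a| ≤ ‖x - y‖ := by
    rw [abs_sub_comm, ha, hb, max_comm R, max_comm R]
    exact (abs_max_sub_max_le_abs _ _ _).trans (abs_norm_sub_norm_le x y)
  have h1 : R / a ≤ 1 := (div_le_one ha0).2 (le_max_left _ _)
  have h2 : ‖y‖ / b ≤ 1 := (div_le_one hb0).2 (le_max_right _ _)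
  rw [e]
  refine (norm_add_le _ _).trans ?_
  rw [norm_smul, norm_smul, Real.norm_of_nonneg (div_nonneg hR.le ha0.le), Real.norm_eq_abs,
    abs_div, abs_mul, abs_of_pos hR, abs_of_pos (mul_pos ha0 hb0)]
  have h3 : R * |b - a| / (a * b) * ‖y‖ = (R / a) * (‖y‖ / b) * |b - a| := by field_simp
  rw [h3]
  have h4 : (R / a) * (‖y‖ / b) ≤ 1 := mul_le_one₀ h1 (by positivity) h2
  have h5 : (R / a) * ‖x - y‖ ≤ 1 * ‖x - y‖ := by gcongr
  have h6 : (R / a) * (‖y‖ / b) * |b - a| ≤ 1 * ‖x - y‖ := by gcongr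
  simp only [NNReal.coe_ofNat]
  linarith

/-- Global solvability of `u' = F(u)` for a dissipative vector field. -/
lemma exists_isMild [CompleteSpace H] {F : H → H} (hF : LipschitzOnBalls F)
    (hd : ∀ x, inner ℝ (F x) x ≤ 0) (u₀ : H) : ∃ u : C(ℝ≥0, H), IsMild F u₀ u := by
  -- Any positive radius at least `‖u₀‖` would serve; the `+ 1` covers `u₀ = 0`.
  set R : ℝ := ‖u₀‖ + 1 with hR
  have hR0 : 0 < R := by positivity
  obtain ⟨K, hK⟩ := hF R
  have hmem : ∀ x : H, radialRetract R x ∈ closedBall (0 : H) R := fun x =>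
    mem_closedBall_zero_iff.2 (norm_radialRetract_le hR0 x)
  have hG : LipschitzWith (K * 2) (fun x => F (radialRetract R x)) := by
    rw [← lipschitzOnWith_univ]
    exact hK.comp (lipschitzWith_radialRetract hR0).lipschitzOnWith fun x _ => hmem x
  have hM : ∀ x, ‖F (radialRetract R x)‖ ≤ (⟨‖F 0‖ + K * R, by positivity⟩ : ℝ≥0) := by
    intro x
    have h := hK.dist_le_mul _ (hmem x) 0 (mem_closedBall_self hR0.le)
    rw [dist_eq_norm, dist_zero_right] at h
    have h' : (K : ℝ) * ‖radialRetract R x‖ ≤ K * R :=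
      mul_le_mul_of_nonneg_left (norm_radialRetract_le hR0 x) K.2
    have h'' := norm_sub_norm_le (F (radialRetract R x)) (F 0)
    change _ ≤ ‖F 0‖ + K * R
    linarith
  obtain ⟨u, hu0, hu⟩ := exists_global_of_bounded_lipschitz hG hM u₀
  have huc : Continuous u := continuous_iff_continuousAt.2 fun t => (hu t).continuousAt
  -- Truncation preserves dissipativity: the retraction of `x` is a positive multiple of `x`.
  have hdis : ∀ x, inner ℝ x (F (radialRetract R x)) ≤ 0 := by
    intro x
    have hc : 0 < R / max R ‖x‖ := div_pos hR0 (lt_max_of_lt_left hR0)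
    have h := hd (radialRetract R x)
    rw [real_inner_comm]
    conv at h => lhs; arg 3; rw [radialRetract]
    rw [real_inner_smul_right] at h
    by_contra hcon
    exact absurd h (not_le.2 (mul_pos hc (not_le.1 hcon)))
  have hanti : Antitone fun t => ‖u t‖ ^ 2 := by
    refine antitone_of_deriv_nonpos (fun t => ((hu t).norm_sq).differentiableAt) fun t => ?_
    rw [(hu t).norm_sq.deriv]
    linarith [hdis (u t)]
  have hnorm : ∀ t, 0 ≤ t → ‖u t‖ ≤ R := by
    intro t ht
    have h := hanti ht
    simp only [hu0] at h
    have := (sq_le_sq₀ (norm_nonneg _) (norm_nonneg _)).1 h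
    linarith
  refine ⟨⟨fun t => u t, by fun_prop⟩, isMild_of_hasDerivAt hF.continuous (by simpa using hu0)
    fun t ht => ?_⟩
  have h := hu t
  rw [radialRetract_of_norm_le hR0 (hnorm t ht.le)] at h
  simp only [ContinuousMap.coe_mk, Real.coe_toNNReal t ht.le]
  refine h.congr_of_eventuallyEq ?_
  filter_upwards [Ioi_mem_nhds ht] with s hs
  rw [Real.coe_toNNReal s (le_of_lt hs)]

end Abstract

/-! ### Continuity of traces and completeness of the energy space -/

lemma edge_inner {L : ℝ} (f g : EdgeL2 L) :
    inner ℝ f g = ∫ x, f x * g x ∂(edgeMeasure L) := by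
  rw [L2.inner_def]
  simp [mul_comm]

lemma edge_inner_eq_of_ae {L : ℝ} (f : EdgeL2 L) {g : EdgeL2 L} {φ : ℝ → ℝ}
    (h : g =ᵐ[edgeMeasure L] φ) : inner ℝ f g = ∫ x, f x * φ x ∂(edgeMeasure L) := by
  rw [edge_inner]
  refine integral_congr_ae ?_
  filter_upwards [h] with x hx
  rw [hx]

lemma integral_mul_eq_inner {L : ℝ} (f : EdgeL2 L) {φ : ℝ → ℝ} (hφ : Continuous φ) :
    ∫ x, f x * φ x ∂(edgeMeasure L) = inner ℝ f (edgeOfContinuous L hφ) :=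
  (edge_inner_eq_of_ae f (coeFn_edgeOfContinuous L hφ)).symm

lemma ACRep.inner_add {L : ℝ} (hL : 0 < L) {F H : ℝ → ℝ} {f g h k : EdgeL2 L}
    (hF : ACRep F f g) (hH : ACRep H h k) :
    inner ℝ f k + inner ℝ g h = F L * H L - F 0 * H 0 := by
  rw [← hF.integral_add hL hH, edge_inner, edge_inner,
    MeasureTheory.integral_add (integrable_edge_mul _ _) (integrable_edge_mul _ _)]

lemma isClosed_hasWeakDeriv {X : Type*} [TopologicalSpace X] {L : ℝ} {f g : X → EdgeL2 L}
    (hf : Continuous f) (hg : Continuous g) : IsClosed {u | HasWeakDeriv (f u) (g u)} := by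
  simp only [HasWeakDeriv, ofPred_forall]
  refine isClosed_iInter fun φ => isClosed_iInter fun hφ => isClosed_iInter fun hc =>
    isClosed_iInter fun hs => ?_
  have h1 : Continuous (deriv φ) := hφ.continuous_deriv (by simp)
  simp only [integral_mul_eq_inner _ h1, integral_mul_eq_inner _ hφ.continuous]
  exact isClosed_eq (by fun_prop) (by fun_prop)

/-- Traces at both ends of an edge are continuous functionals of `(f, f')`. -/
lemma exists_trace_functional {L : ℝ} (hL : 0 < L) {p : ℝ} (hp : p = 0 ∨ p = L) :
    ∃ a b : EdgeL2 L, ∀ (F : ℝ → ℝ) (f g : EdgeL2 L), ACRep F f g →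
      F p = inner ℝ f a + inner ℝ g b := by
  rcases hp with rfl | rfl
  -- Integrating by parts against an affine function that vanishes at the other end isolates one
  -- trace; the value `-1` at `0` absorbs the sign of the boundary term.
  · have h : ContDiff ℝ 1 fun x : ℝ => x / L - 1 := by fun_prop
    refine ⟨_, _, fun F f g hF => ((hF.inner_add hL (acRep_of_contDiff L h)).trans ?_).symm⟩
    rw [div_self hL.ne']; ring
  · have h : ContDiff ℝ 1 fun x : ℝ => x / p := by fun_prop
    refine ⟨_, _, fun F f g hF => ((hF.inner_add hL (acRep_of_contDiff p h)).trans ?_).symm⟩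
    rw [div_self hL.ne']; ring

variable {N : ℕ} {ℓ : Fin N → ℝ}

/-- The component on an edge as a bounded operator on jets. -/
def jetFst (ℓ : Fin N → ℝ) (j : Fin N) : JetSpace ℓ →L[ℝ] EdgeL2 (ℓ j) :=
  (WithLp.fstL 2 ℝ _ _).comp (PiLp.proj 2 _ j)

/-- The derivative on an edge as a bounded operator on jets. -/
def jetSnd (ℓ : Fin N → ℝ) (j : Fin N) : JetSpace ℓ →L[ℝ] EdgeL2 (ℓ j) :=
  (WithLp.sndL 2 ℝ _ _).comp (PiLp.proj 2 _ j)

lemma jetFst_apply (u : JetSpace ℓ) (j : Fin N) : jetFst ℓ j u = (u j).fst := rfl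

lemma jetSnd_apply (u : JetSpace ℓ) (j : Fin N) : jetSnd ℓ j u = (u j).snd := rfl

/-- Each condition is closed: weak differentiability by testing, the traces because they are bounded
functionals of the jet. Comparing every node trace with that of edge `0` removes the quantifier over
the common value. -/
lemma isClosed_H1eSubmodule (hN : 0 < N) (hℓ : ∀ j, 0 < ℓ j) :
    IsClosed (H1eSubmodule ℓ : Set (JetSpace ℓ)) := by
  choose a b hab using fun j => exists_trace_functional (hℓ j) (Or.inl (rfl : (0 : ℝ) = 0))
  choose a' b' hab' using fun j => exists_trace_functional (hℓ j) (Or.inr (rfl : ℓ j = ℓ j))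
  have e : (H1eSubmodule ℓ : Set (JetSpace ℓ)) =
      (⋂ j, {u | HasWeakDeriv (jetFst ℓ j u) (jetSnd ℓ j u)}) ∩
      ((⋂ j, {u | inner ℝ (jetFst ℓ j u) (a' j) + inner ℝ (jetSnd ℓ j u) (b' j) = 0}) ∩
      ⋂ j, {u | inner ℝ (jetFst ℓ j u) (a j) + inner ℝ (jetSnd ℓ j u) (b j) =
        inner ℝ (jetFst ℓ ⟨0, hN⟩ u) (a ⟨0, hN⟩) + inner ℝ (jetSnd ℓ ⟨0, hN⟩ u) (b ⟨0, hN⟩)}) := by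
    ext u
    simp only [mem_inter_iff, mem_iInter, mem_ofPred_eq, jetFst_apply, jetSnd_apply]
    constructor
    · rintro ⟨hw, h1, c, hc⟩
      choose F hF using fun j => (hw j).exists_acRep (hℓ j)
      refine ⟨hw, fun j => ?_, fun j => ?_⟩
      · rw [← hab' j _ _ _ (hF j)]
        exact (hF j).eq_of_hasTrace (hℓ j) (right_mem_Icc.2 (hℓ j).le) (h1 j)
      · rw [← hab _ _ _ _ (hF _), ← hab _ _ _ _ (hF _),
          (hF _).eq_of_hasTrace (hℓ _) (left_mem_Icc.2 (hℓ _).le) (hc _),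
          (hF _).eq_of_hasTrace (hℓ _) (left_mem_Icc.2 (hℓ _).le) (hc _)]
    · rintro ⟨hw, h1, hc⟩
      choose F hF using fun j => (hw j).exists_acRep (hℓ j)
      refine ⟨hw, fun j => ?_, F ⟨0, hN⟩ 0, fun j => ?_⟩
      · rw [← h1 j, ← hab' j _ _ _ (hF j)]
        exact (hF j).hasTrace (hℓ j) _
      · rw [hab _ _ _ _ (hF _), ← hc j, ← hab _ _ _ _ (hF j)]
        exact (hF j).hasTrace (hℓ j) _
  rw [e]
  refine (isClosed_iInter fun j => isClosed_hasWeakDeriv (by fun_prop) (by fun_prop)).inter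
    ((isClosed_iInter fun j => isClosed_eq (by fun_prop) (by fun_prop)).inter
      (isClosed_iInter fun j => isClosed_eq (by fun_prop) (by fun_prop)))

lemma completeSpace_H1e (hN : 0 < N) (hℓ : ∀ j, 0 < ℓ j) : CompleteSpace (H1e ℓ) :=
  (isClosed_H1eSubmodule hN hℓ).completeSpace_coe

/-! ### Bounded operators on the energy space -/

/-- `u ↦ u_j` as a bounded operator. -/
def H1e.compL (j : Fin N) : H1e ℓ →L[ℝ] EdgeL2 (ℓ j) := (jetFst ℓ j).comp (Submodule.subtypeL _)

/-- `u ↦ ∂ₓu_j` as a bounded operator. -/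
def H1e.dxL (j : Fin N) : H1e ℓ →L[ℝ] EdgeL2 (ℓ j) := (jetSnd ℓ j).comp (Submodule.subtypeL _)

lemma H1e.compL_apply (u : H1e ℓ) (j : Fin N) : H1e.compL j u = u.comp j := rfl

lemma H1e.dxL_apply (u : H1e ℓ) (j : Fin N) : H1e.dxL j u = u.dx j := rfl

lemma H1e.exists_acRep (hℓ : ∀ j, 0 < ℓ j) (u : H1e ℓ) (j : Fin N) :
    ∃ U : ℝ → ℝ, ACRep U (u.comp j) (u.dx j) ∧ U (ℓ j) = 0 ∧ U 0 = u.node := by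
  obtain ⟨U, hU⟩ := (u.2.1 j).exists_acRep (hℓ j)
  exact ⟨U, hU, hU.eq_of_hasTrace (hℓ j) (right_mem_Icc.2 (hℓ j).le) (u.2.2.1 j),
    hU.eq_of_hasTrace (hℓ j) (left_mem_Icc.2 (hℓ j).le) (u.hasTrace_node j)⟩

lemma H1e.inner_eq_edge (u v : H1e ℓ) :
    inner ℝ u v = ∑ j, (inner ℝ (u.comp j) (v.comp j) + inner ℝ (u.dx j) (v.dx j)) := by
  rw [H1e.inner_eq]
  refine Finset.sum_congr rfl fun j _ => ?_
  rw [edge_inner, edge_inner,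
    MeasureTheory.integral_add (integrable_edge_mul _ _) (integrable_edge_mul _ _)]

lemma H1e.exists_nodeL (hN : 0 < N) (hℓ : ∀ j, 0 < ℓ j) :
    ∃ T : H1e ℓ →L[ℝ] ℝ, ∀ u, T u = u.node := by
  obtain ⟨a, b, hab⟩ := exists_trace_functional (hℓ ⟨0, hN⟩) (Or.inl (rfl : (0 : ℝ) = 0))
  refine ⟨(innerSL ℝ a).comp (H1e.compL _) + (innerSL ℝ b).comp (H1e.dxL _), fun u => ?_⟩
  obtain ⟨U, hU, -, h0⟩ := u.exists_acRep hℓ ⟨0, hN⟩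
  rw [← h0, hab _ _ _ hU]
  simp [H1e.compL_apply, H1e.dxL_apply, real_inner_comm]

/-- Multiplication by the values of an essentially bounded family is bounded on `L²`. -/
lemma exists_mulL_of_bound {X : Type*} [NormedAddCommGroup X] [NormedSpace ℝ X] {L C : ℝ}
    (hC : 0 ≤ C) (S : X →L[ℝ] EdgeL2 L)
    (hbd : ∀ u, ∀ᵐ x ∂(edgeMeasure L), ‖S u x‖ ≤ C * ‖u‖) :
    ∃ M : X →L[ℝ] EdgeL2 L →L[ℝ] EdgeL2 L,
      ∀ u g, M u g =ᵐ[edgeMeasure L] fun x => S u x * g x := by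
  have hm : ∀ u, MemLp (S u) ⊤ (edgeMeasure L) := fun u =>
    memLp_top_of_bound (Lp.memLp _).1 _ (hbd u)
  let T : X →ₗ[ℝ] Lp ℝ ⊤ (edgeMeasure L) :=
    { toFun := fun u => (hm u).toLp
      map_add' := fun u v => by
        rw [← MemLp.toLp_add]
        refine MemLp.toLp_congr _ _ ?_
        rw [map_add]
        exact Lp.coeFn_add _ _
      map_smul' := fun c u => by
        rw [RingHom.id_apply, ← MemLp.toLp_const_smul]
        refine MemLp.toLp_congr _ _ ?_
        rw [map_smul]
        exact Lp.coeFn_smul _ _ }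
  have hT' : ∀ u, T u =ᵐ[edgeMeasure L] S u := fun u => (hm u).coeFn_toLp
  have hT : ∀ u, ‖T u‖ ≤ C * ‖u‖ := fun u => by
    have h := Lp.norm_le_of_ae_bound (f := T u) (C := C * ‖u‖) (by positivity) (by
      filter_upwards [hT' u, hbd u] with x h1 h2
      rwa [h1])
    simpa using h
  refine ⟨((ContinuousLinearMap.mul ℝ ℝ).holderL (edgeMeasure L) ⊤ 2 2).comp
    (T.mkContinuous C hT), fun u g => ?_⟩
  filter_upwards [(ContinuousLinearMap.mul ℝ ℝ).coeFn_holder (r := 2) (T u) g, hT' u] with x h1 h2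
  rw [h2] at h1
  exact h1

lemma H1e.exists_mulL (hℓ : ∀ j, 0 < ℓ j) (j : Fin N) :
    ∃ M : H1e ℓ →L[ℝ] EdgeL2 (ℓ j) →L[ℝ] EdgeL2 (ℓ j),
      ∀ u g, M u g =ᵐ[edgeMeasure (ℓ j)] fun x => u.comp j x * g x := by
  refine exists_mulL_of_bound (by positivity : 0 ≤
    ‖edgeOfContinuous (ℓ j) (continuous_const (y := (1 : ℝ)))‖ * ‖H1e.dxL (ℓ := ℓ) j‖)
    (H1e.compL j) fun u => ?_
  obtain ⟨U, hU, h1, -⟩ := u.exists_acRep hℓ j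
  filter_upwards [hU.ae_eq, ae_restrict_mem measurableSet_Ioo] with x hx hx'
  rw [H1e.compL_apply, hx, Real.norm_eq_abs, mul_assoc]
  refine (hU.abs_le (hℓ j) h1 (Ioo_subset_Icc_self hx')).trans
    ((integral_abs_le_norm _).trans ?_)
  gcongr
  exact (H1e.dxL j).le_opNorm u

/-! ### The weak form, its vector field and the energy identity -/

/-- The spatial part of the weak formulation, tested against `φ`. -/
def weakForm (α : ℝ) (u φ : H1e ℓ) : ℝ :=
  (∑ j, ∫ x, (u.dx j x + u.comp j x * u.dx j x) * φ.comp j x ∂(edgeMeasure (ℓ j)))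
    + (α * u.node + (N : ℝ) / 3 * u.node ^ 2) * φ.node

/-- `p` is the family `∂ₓu_j + u_j ∂ₓu_j` of elements of `L²`. -/
def IsFlux (u : H1e ℓ) (p : ∀ j, EdgeL2 (ℓ j)) : Prop :=
  ∀ j, p j =ᵐ[edgeMeasure (ℓ j)] fun x => u.dx j x + u.comp j x * u.dx j x

lemma IsFlux.weakForm_eq {u : H1e ℓ} {p : ∀ j, EdgeL2 (ℓ j)} (hp : IsFlux u p) (α : ℝ)
    (φ : H1e ℓ) : weakForm α u φ = (∑ j, inner ℝ (p j) (φ.comp j))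
      + (α * u.node + (N : ℝ) / 3 * u.node ^ 2) * φ.node := by
  rw [weakForm]
  congr 1
  refine Finset.sum_congr rfl fun j _ => ?_
  rw [edge_inner]
  refine integral_congr_ae ?_
  filter_upwards [hp j] with x hx
  rw [hx]

lemma exists_isFlux (hℓ : ∀ j, 0 < ℓ j) (u : H1e ℓ) : ∃ p : ∀ j, EdgeL2 (ℓ j), IsFlux u p := by
  choose M hM using fun j => H1e.exists_mulL hℓ j
  refine ⟨fun j => u.dx j + M j u (u.dx j), fun j => ?_⟩
  filter_upwards [Lp.coeFn_add (u.dx j) (M j u (u.dx j)), hM j u (u.dx j)] with x h1 h2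
  rw [h1, Pi.add_apply, h2]

/-- The vector field representing the weak form, which is Lipschitz on balls. -/
lemma exists_vectorField (hN : 0 < N) (hℓ : ∀ j, 0 < ℓ j) (α : ℝ) :
    ∃ F : H1e ℓ → H1e ℓ, LipschitzOnBalls F ∧ ∀ u φ, inner ℝ (F u) φ = -weakForm α u φ := by
  have := completeSpace_H1e hN hℓ
  choose M hM using fun j => H1e.exists_mulL hℓ j
  obtain ⟨T, hT⟩ := H1e.exists_nodeL hN hℓ
  -- The adjoints of `u ↦ u_j` and of the node value carry the L² fluxes and the scalar node term
  -- back into ℍ¹ₑ.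
  refine ⟨fun u => -((∑ j, ContinuousLinearMap.adjoint (𝕜 := ℝ) (H1e.compL j) (H1e.dxL j u + M j u (H1e.dxL j u)))
    + ContinuousLinearMap.adjoint (𝕜 := ℝ) T ((α • T) u + ((ContinuousLinearMap.mul ℝ ℝ).comp (((N : ℝ) / 3) • T)) u (T u))),
    ?_, fun u φ => ?_⟩
  · refine LipschitzOnBalls.neg (LipschitzOnBalls.add (LipschitzOnBalls.sum _ fun j => ?_) ?_)
    · exact LipschitzOnBalls.clm_comp _
        ((lipschitzOnBalls_clm _).add (lipschitzOnBalls_bilin _ _))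
    · exact LipschitzOnBalls.clm_comp _
        ((lipschitzOnBalls_clm _).add (lipschitzOnBalls_bilin _ _))
  · have hp : IsFlux u fun j => u.dx j + M j u (u.dx j) := fun j => by
      filter_upwards [Lp.coeFn_add (u.dx j) (M j u (u.dx j)), hM j u (u.dx j)] with x h1 h2
      rw [h1, Pi.add_apply, h2]
    rw [hp.weakForm_eq, inner_neg_left, inner_add_left, sum_inner,
      ContinuousLinearMap.adjoint_inner_left]
    simp only [ContinuousLinearMap.adjoint_inner_left, H1e.compL_apply, H1e.dxL_apply]
    congr 2
    simp [hT]
    ring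

/-- The energy identity. -/
lemma weakForm_self (hℓ : ∀ j, 0 < ℓ j) (α : ℝ) (u : H1e ℓ) :
    weakForm α u u = (α - N / 2) * u.node ^ 2 := by
  have h : ∀ j, ∫ x, (u.dx j x + u.comp j x * u.dx j x) * u.comp j x ∂(edgeMeasure (ℓ j))
      = -(u.node ^ 2 / 2 + u.node ^ 3 / 3) := by
    intro j
    obtain ⟨U, hU, h1, h0⟩ := u.exists_acRep hℓ j
    have h2 := hU.ac.fun_mul hU.ac
    -- `U² / 2 + U³ / 3` is a primitive of `(U' + U U') U`. Its boundary values sum over the edges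
    -- to `-(N/2) c² - (N/3) c³`, with `c` the node value, and the cubic part cancels the quadratic
    -- node term tested against `u`.
    have hac := (h2.const_mul (1 / 2)).add ((h2.fun_mul hU.ac).const_mul (1 / 3))
    have e := hac.integral_deriv_eq_sub
    rw [intervalIntegral_eq_edge (hℓ j)] at e
    simp only [Pi.add_apply, h1, h0] at e
    refine Eq.trans (integral_congr_ae ?_) (e.trans (by ring))
    filter_upwards [hU.ae_eq, hU.deriv_ae_eq,
      ae_edge_of_ae_uIcc (hℓ j) hU.ac.ae_differentiableAt] with x hx hx' hd
    have hd := hd.hasDerivAt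
    have hd2 := (((hd.fun_mul hd).const_mul (1 / 2)).add
      (((hd.fun_mul hd).fun_mul hd).const_mul (1 / 3))).deriv
    rw [hd2, hx, ← hx']
    ring
  rw [weakForm]
  simp only [h, Finset.sum_const, Finset.card_univ, Fintype.card_fin, nsmul_eq_mul]
  ring

/-! ### Strong form versus variational identity -/

/-- Continuously differentiable families with the right end point values define elements of the
energy space. -/
lemma exists_H1e_of_contDiff (hN : 0 < N) (hℓ : ∀ j, 0 < ℓ j) {Φ : Fin N → ℝ → ℝ}
    (hΦ : ∀ j, ContDiff ℝ 1 (Φ j)) (h1 : ∀ j, Φ j (ℓ j) = 0) {c : ℝ} (h0 : ∀ j, Φ j 0 = c) :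
    ∃ φ : H1e ℓ, φ.node = c ∧ ∀ j, φ.comp j =ᵐ[edgeMeasure (ℓ j)] Φ j ∧
      φ.dx j =ᵐ[edgeMeasure (ℓ j)] deriv (Φ j) := by
  have hr := fun j => acRep_of_contDiff (ℓ j) (hΦ j)
  let φ : H1e ℓ := ⟨WithLp.toLp 2 fun j => WithLp.toLp 2 (edgeOfContinuous (ℓ j) (hΦ j).continuous,
      edgeOfContinuous (ℓ j) ((hΦ j).continuous_deriv le_rfl)),
    fun j => (hr j).hasWeakDeriv (hℓ j), fun j => h1 j ▸ (hr j).hasTrace (hℓ j) (ℓ j),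
    c, fun j => h0 j ▸ (hr j).hasTrace (hℓ j) 0⟩
  refine ⟨φ, ?_, fun j => ⟨coeFn_edgeOfContinuous _ (hΦ j).continuous,
    coeFn_edgeOfContinuous _ ((hΦ j).continuous_deriv le_rfl)⟩⟩
  rw [← h0 ⟨0, hN⟩]
  exact ((hr _).eq_of_hasTrace (hℓ _) (left_mem_Icc.2 (hℓ _).le) (φ.hasTrace_node _)).symm

/-- Green's formula for an element of the energy space with derivative in `H¹`. -/
lemma inner_eq_of_acRep_dx (hℓ : ∀ j, 0 < ℓ j) {v : H1e ℓ} {G : Fin N → ℝ → ℝ}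
    {w : ∀ j, EdgeL2 (ℓ j)} (hG : ∀ j, ACRep (G j) (v.dx j) (w j)) (φ : H1e ℓ) :
    inner ℝ v φ = (∑ j, inner ℝ (v.comp j - w j) (φ.comp j)) - (∑ j, G j 0) * φ.node := by
  rw [H1e.inner_eq_edge, Finset.sum_mul, ← Finset.sum_sub_distrib]
  refine Finset.sum_congr rfl fun j _ => ?_
  obtain ⟨P, hP, h1, h0⟩ := φ.exists_acRep hℓ j
  have h := (hG j).inner_add (hℓ j) hP
  rw [h1, h0] at h
  rw [inner_sub_left]
  linarith

/-- `v` is the time derivative prescribed by the strong form of the system at the state `u`. -/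
def StrongForm (α : ℝ) (u v : H1e ℓ) : Prop :=
  ∃ (w : ∀ j, EdgeL2 (ℓ j)) (d : Fin N → ℝ),
    (∀ j, HasWeakDeriv (v.dx j) (w j)) ∧
    (∀ j, HasTrace (v.dx j) 0 (d j)) ∧
    (∀ j, ∀ᵐ x ∂(edgeMeasure (ℓ j)),
      v.comp j x - w j x + u.dx j x + u.comp j x * u.dx j x = 0) ∧
    ∑ j, d j = α * u.node + (N : ℝ) / 3 * u.node ^ 2

/-- In Green's formula the equation identifies the bulk term with minus the flux, and the flux
condition identifies the boundary term. -/
lemma StrongForm.inner_eq (hℓ : ∀ j, 0 < ℓ j) {α : ℝ} {u v : H1e ℓ} (h : StrongForm α u v)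
    (φ : H1e ℓ) : inner ℝ v φ = -weakForm α u φ := by
  obtain ⟨w, d, hw, hd, heq, hsum⟩ := h
  choose G hG using fun j => (hw j).exists_acRep (hℓ j)
  have hGd : ∀ j, G j 0 = d j := fun j =>
    (hG j).eq_of_hasTrace (hℓ j) (left_mem_Icc.2 (hℓ j).le) (hd j)
  have hp : IsFlux u fun j => -(v.comp j - w j) := fun j => by
    filter_upwards [heq j, Lp.coeFn_neg (v.comp j - w j), Lp.coeFn_sub (v.comp j) (w j)]
      with x h1 h2 h3
    rw [h2, Pi.neg_apply, h3, Pi.sub_apply]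
    linarith
  rw [inner_eq_of_acRep_dx hℓ hG, hp.weakForm_eq]
  simp only [hGd, hsum, inner_neg_left, Finset.sum_neg_distrib]
  ring

/-- Test functions living on one edge yield the equation and the H² regularity; one test function
that does not vanish at the node then yields the flux condition. -/
lemma strongForm_of_inner_eq (hN : 0 < N) (hℓ : ∀ j, 0 < ℓ j) {α : ℝ} {u v : H1e ℓ}
    (h : ∀ φ, inner ℝ v φ = -weakForm α u φ) : StrongForm α u v := by
  obtain ⟨p, hp⟩ := exists_isFlux hℓ u
  have hw : ∀ j, HasWeakDeriv (v.dx j) (v.comp j + p j) := by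
    intro j φ hφ hc hs
    have hz : ∀ x, x ∉ Ioo 0 (ℓ j) → φ x = 0 := fun x hx =>
      image_eq_zero_of_notMem_tsupport fun h' => hx (hs h')
    -- Extending `φ` by zero to the other edges gives an element of ℍ¹ₑ with node value `0`, so the
    -- node term drops out.
    set Φ : Fin N → ℝ → ℝ := fun k => if k = j then φ else 0 with hΦ
    have hΦj : Φ j = φ := by simp [hΦ]
    have hΦk : ∀ k, k ≠ j → Φ k = 0 := fun k hk => by simp [hΦ, hk]
    have hΦd : ∀ k, ContDiff ℝ 1 (Φ k) := fun k => by
      by_cases hk : k = j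
      · subst hk; rw [hΦj]; exact hφ.of_le (by simp)
      · rw [hΦk k hk]; exact contDiff_const
    obtain ⟨ψ, hψ0, hψ⟩ := exists_H1e_of_contDiff hN hℓ hΦd (c := 0)
      (fun k => by
        by_cases hk : k = j
        · subst hk; rw [hΦj]; exact hz _ (by simp)
        · rw [hΦk k hk]; rfl)
      (fun k => by
        by_cases hk : k = j
        · subst hk; rw [hΦj]; exact hz _ (by simp)
        · rw [hΦk k hk]; rfl)
    have e := h ψ
    rw [H1e.inner_eq_edge, hp.weakForm_eq, hψ0, mul_zero, add_zero,
      ← Finset.sum_neg_distrib] at e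
    simp only [fun k f => edge_inner_eq_of_ae f (hψ k).1,
      fun k f => edge_inner_eq_of_ae f (hψ k).2] at e
    rw [Finset.sum_eq_single j (fun k _ hk => by simp [hΦk k hk]) (by simp),
      Finset.sum_eq_single j (fun k _ hk => by simp [hΦk k hk]) (by simp), hΦj] at e
    have e' : ∫ x, (v.comp j + p j) x * φ x ∂(edgeMeasure (ℓ j))
        = ∫ x, (v.comp j x * φ x + p j x * φ x) ∂(edgeMeasure (ℓ j)) :=
      integral_congr_ae (by
        filter_upwards [Lp.coeFn_add (v.comp j) (p j)] with x hx
        rw [hx, Pi.add_apply, add_mul])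
    rw [e', integral_add (integrable_mul_test _ hφ.continuous hc)
      (integrable_mul_test _ hφ.continuous hc)]
    linarith
  choose G hG using fun j => (hw j).exists_acRep (hℓ j)
  refine ⟨_, fun j => G j 0, hw, fun j => (hG j).hasTrace (hℓ j) 0, fun j => ?_, ?_⟩
  · filter_upwards [hp j, Lp.coeFn_add (v.comp j) (p j)] with x h1 h2
    rw [h2, Pi.add_apply, h1]
    ring
  -- The hat function with node value `1`: the bulk terms cancel by the equation already obtained,
  -- leaving the flux balance.
  · obtain ⟨φ, hφ, -⟩ := exists_H1e_of_contDiff hN hℓ (Φ := fun j x => 1 - x / ℓ j)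
      (fun j => by fun_prop) (fun j => by rw [div_self (hℓ j).ne', sub_self]) (c := 1)
      (fun j => by simp)
    have e := h φ
    rw [inner_eq_of_acRep_dx hℓ hG, hp.weakForm_eq, hφ] at e
    simp only [sub_add_cancel_left, inner_neg_left, Finset.sum_neg_distrib] at e
    linarith

/-! ### Both notions of solution as one integral equation -/

section VectorField

variable {α : ℝ} {F : H1e ℓ → H1e ℓ}

lemma isSolution_iff_isMild (hN : 0 < N) (hℓ : ∀ j, 0 < ℓ j) (hF : LipschitzOnBalls F)
    (hFw : ∀ u φ, inner ℝ (F u) φ = -weakForm α u φ) (u₀ : H1e ℓ) (u : C(ℝ≥0, H1e ℓ)) :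
    IsSolution α u₀ u ↔ IsMild F u₀ u := by
  have := completeSpace_H1e hN hℓ
  constructor
  · rintro ⟨h0, h⟩
    refine isMild_of_hasDerivAt hF.continuous h0 fun t ht => ?_
    obtain ⟨v, hv, hs⟩ := h t ht
    have hs' : StrongForm α (u t.toNNReal) v := hs
    have e : v = F (u t.toNNReal) := ext_inner_right ℝ fun φ => by
      rw [hs'.inner_eq hℓ, hFw]
    exact e ▸ hv
  · intro h
    exact ⟨h.apply_zero, fun t ht => ⟨_, h.hasDerivAt hF.continuous ht,
      strongForm_of_inner_eq hN hℓ (hFw _)⟩⟩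

/-- Pairing with `φ` commutes with the time integral, so the weak formulation is the mild equation
tested against every `φ`. -/
lemma isWeakSolution_iff_isMild (hN : 0 < N) (hℓ : ∀ j, 0 < ℓ j) (hF : LipschitzOnBalls F)
    (hFw : ∀ u φ, inner ℝ (F u) φ = -weakForm α u φ) (u₀ : H1e ℓ) (u : C(ℝ≥0, H1e ℓ)) :
    IsWeakSolution α u₀ u ↔ IsMild F u₀ u := by
  have := completeSpace_H1e hN hℓ
  have hc : Continuous fun s : ℝ => F (u s.toNNReal) := by
    have := hF.continuous
    fun_prop
  have key : ∀ (φ : H1e ℓ) (t : ℝ≥0),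
      inner ℝ (u₀ + ∫ s in (0 : ℝ)..t, F (u s.toNNReal)) φ
        = inner ℝ u₀ φ - ∫ s in (0 : ℝ)..t, weakForm α (u s.toNNReal) φ := by
    intro φ t
    have e := (innerSL ℝ φ).intervalIntegral_comp_comm
      (hc.intervalIntegrable (μ := volume) 0 (t : ℝ))
    have e' : ∀ s : ℝ, innerSL ℝ φ (F (u s.toNNReal)) = -weakForm α (u s.toNNReal) φ := fun s => by
      rw [← hFw, real_inner_comm]; rfl
    simp only [e', intervalIntegral.integral_neg] at e
    rw [inner_add_left, sub_eq_add_neg, e, innerSL_apply_apply,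
      real_inner_comm φ (∫ s in (0 : ℝ)..t, F (u s.toNNReal))]
  constructor
  · intro h t
    exact ext_inner_right ℝ fun φ => (h φ t).trans (key φ t).symm
  · intro h φ t
    rw [h t]
    exact key φ t

end VectorField

end

end StarBBM


/-- Well-posedness of the nonlinear system on the star network: there is exactly one solution in
`C([0,∞), ℍ¹ₑ)`, both among strong and among weak solutions, and it is the same one. -/
theorem mainTheorem2 (N : ℕ) (hN : 0 < N) (ℓ : Fin N → ℝ) (hℓ : ∀ j, 0 < ℓ j) (α : ℝ)
    (hα : (N : ℝ) / 2 < α) (u₀ : StarBBM.H1e ℓ) :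
    ∃ u : C(NNReal, StarBBM.H1e ℓ),
      StarBBM.IsSolution α u₀ u ∧ StarBBM.IsWeakSolution α u₀ u ∧
      ∀ w : C(NNReal, StarBBM.H1e ℓ),
        StarBBM.IsSolution α u₀ w ∨ StarBBM.IsWeakSolution α u₀ w → w = u := by
  have := StarBBM.completeSpace_H1e hN hℓ
  obtain ⟨F, hF, hFw⟩ := StarBBM.exists_vectorField hN hℓ α
  -- The threshold `N / 2` for `α` enters only here, as the sign in the energy identity.
  have hd : ∀ x, inner ℝ (F x) x ≤ 0 := fun x => by
    rw [hFw, StarBBM.weakForm_self hℓ, neg_nonpos]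
    exact mul_nonneg (sub_nonneg.2 hα.le) (sq_nonneg _)
  obtain ⟨u, hu⟩ := StarBBM.exists_isMild hF hd u₀
  refine ⟨u, (StarBBM.isSolution_iff_isMild hN hℓ hF hFw u₀ u).2 hu,
    (StarBBM.isWeakSolution_iff_isMild hN hℓ hF hFw u₀ u).2 hu, fun w hw => ?_⟩
  rcases hw with hw | hw
  · exact ((StarBBM.isSolution_iff_isMild hN hℓ hF hFw u₀ w).1 hw).unique hF hu
  · exact ((StarBBM.isWeakSolution_iff_isMild hN hℓ hF hFw u₀ w).1 hw).unique hF hu
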